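/- Let $k$ be a field and $Q$ a quiver with finitely many vertices and arrows (loops and parallel arrows allowed), and let $kQ$ be its path algebra, with basis all paths (including the trivial path at each vertex) and multiplication by concatenation. Assume that the Gelfand–Kirillov dimension of $kQ$, $\operatorname{GKdim} kQ=\sup_W\limsup_{n\to\infty}\frac{\log\dim_k(W^0+W^1+\cdots+W^n)}{\log n}$ ($W$ ranging over the finite-dimensional subspaces of $kQ$; the zero algebra has dimension $0$), is finite. A path with successive vertices $v_0,\dots,v_m$ is a simple chain if $v_0,\dots,v_m$ are pairwise distinct; a chain if its arrows are pairwise distinct; a cycle if it is a chain with $m\ge 1$ and $v_0=v_m$; a simple cycle if $m\ge1$, $v_0=v_m$ and $v_0,\dots,v_{m-1}$ are pairwise distinct. A vertex is cyclic if it lies on some cycle. Let $\mathcal C(Q)$ be the set of simple cycles of $Q$, each regarded as the subquiver formed by its vertices and arrows, with $C_1\preceq C_2$ if there is a simple chain from a vertex of $C_1$ to a vertex of $C_2$, or $C_1$ and $C_2$ have a common vertex. Let $E_Q$ (the Ext-quiver) be the quiver whose vertices are the cyclic vertices of $Q$, with one arrow $v\to w$ if $Q$ has a path from $v$ to $w$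 whose length is a positive multiple of $nm$, where $n$ and $m$ are the lengths of the simple cycles containing $v$ and $w$; put $v\preceq w$ if $v=w$ or there is an arrow $v\to w$ in $E_Q$. Then $(\mathcal C(Q),\preceq)$ and $(E_Q,\preceq)$ are partially ordered sets, and for every integer $d\ge 0$ there is a totally ordered subset of $\mathcal C(Q)$ with $d$ elements if and only if there is a totally ordered subset of $E_Q$ with $d$ elements. Consequently, totally ordered subsets of $E_Q$ have a maximal number of elements, and $\operatorname{GKdim} kQ$ equals this maximum. -/

import Mathlib

universe w v u

/-! ### Paths, cycles, subquivers -/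

namespace Quiver

namespace Path

variable {V : Type u} [Quiver.{v} V]

/-- The list `a₁, …, aₘ` of the arrows of a path (with their end points). -/
def arrows {a : V} : ∀ {b : V}, Path a b → List (Total V)
  | _, .nil => []
  | _, .cons p e => arrows p ++ [⟨_, _, e⟩]

/-- A chain: the arrows are pairwise distinct. -/
def IsChain {a b : V} (p : Path a b) : Prop := p.arrows.Nodup

/-- A simple chain: the vertices `v₀, …, vₘ` are pairwise distinct. -/
def IsSimpleChain {a b : V} (p : Path a b) : Prop := p.vertices.Nodup

/-- A cycle: a closed chain (of positive length). -/
def IsCycle {a : V} (p : Path a a) : Prop := 0 < p.length ∧ p.IsChain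

/-- A simple cycle: a closed path `v₀, …, vₘ = v₀` of positive length for which
`v₀, …, vₘ₋₁` are pairwise distinct. -/
def IsSimpleCycle {a : V} (p : Path a a) : Prop :=
  0 < p.length ∧ p.vertices.dropLast.Nodup

theorem left_mem_vertices {a b : V} (p : Path a b) :
    ∀ e ∈ p.arrows, e.left ∈ p.vertices := by
  induction p with
  | nil => simp [arrows]
  | cons p e ih =>
    intro f hf
    rw [mem_vertices_cons]
    rcases List.mem_append.1 hf with h | h
    · exact Or.inl (ih f h)
    · rw [List.mem_singleton.1 h]
      exact Or.inl p.end_mem_vertices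

theorem right_mem_vertices {a b : V} (p : Path a b) :
    ∀ e ∈ p.arrows, e.right ∈ p.vertices := by
  induction p with
  | nil => simp [arrows]
  | cons p e ih =>
    intro f hf
    rw [mem_vertices_cons]
    rcases List.mem_append.1 hf with h | h
    · exact Or.inl (ih f h)
    · rw [List.mem_singleton.1 h]
      exact Or.inr rfl

end Path

/-- A subquiver: a set of vertices and a set of arrows between them. -/
@[ext]
structure Subquiver (V : Type u) [Quiver.{v} V] where
  verts : Set V
  arrows : Set (Total V)
  left_mem : ∀ e ∈ arrows, e.left ∈ verts
  right_mem : ∀ e ∈ arrows, e.right ∈ verts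

/-- The subquiver `Q(p)` of all the vertices and arrows that make up the path `p`. -/
def Path.subquiver {V : Type u} [Quiver.{v} V] {a b : V} (p : Path a b) : Subquiver V where
  verts := {x | x ∈ p.vertices}
  arrows := {e | e ∈ p.arrows}
  left_mem := p.left_mem_vertices
  right_mem := p.right_mem_vertices

/-- The set of simple cycles of a quiver, as subquivers. -/
def SimpleCycles (V : Type u) [Quiver.{v} V] : Type (max u v) :=
  {C : Subquiver V // ∃ (a : V) (p : Path a a), p.IsSimpleCycle ∧ C = p.subquiver}

/-- `C₁ ≼ C₂` if there is a simple chain from a vertex of `C₁` to a vertex of `C₂`, or if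
`C₁` and `C₂` share a vertex. -/
def SimpleCycles.le {V : Type u} [Quiver.{v} V] (C₁ C₂ : SimpleCycles V) : Prop :=
  (∃ a ∈ C₁.1.verts, ∃ b ∈ C₂.1.verts, ∃ p : Path a b, p.IsSimpleChain) ∨
    ∃ a, a ∈ C₁.1.verts ∧ a ∈ C₂.1.verts

/-- A vertex is cyclic if it is part of some cycle. -/
def IsCyclicVertex {V : Type u} [Quiver.{v} V] (x : V) : Prop :=
  ∃ (a : V) (p : Path a a), p.IsCycle ∧ x ∈ p.vertices

/-- The vertices of the Ext-quiver are the cyclic vertices. -/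
def ExtQuiver (V : Type u) [Quiver.{v} V] : Type u := {x : V // IsCyclicVertex x}

/-- There is one arrow `x ⟶ y` in the Ext-quiver if there is a path from `x` to `y` whose length
is a positive multiple of `n * m`, where `n` and `m` are the lengths of the simple cycles
containing `x` and `y`. -/
instance {V : Type u} [Quiver.{v} V] : Quiver.{0} (ExtQuiver V) where
  Hom x y := PLift (∃ (a b : V) (p : Path a a) (q : Path b b),
    p.IsSimpleCycle ∧ x.1 ∈ p.vertices ∧ q.IsSimpleCycle ∧ y.1 ∈ q.vertices ∧
    ∃ (r : Path x.1 y.1) (l : ℕ), 0 < l ∧ r.length = l * (p.length * q.length))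

/-- `x ≼ y` in the Ext-quiver if `x = y` or there is an arrow `x ⟶ y`. -/
def ExtQuiver.le {V : Type u} [Quiver.{v} V] (x y : ExtQuiver V) : Prop :=
  x = y ∨ Nonempty (x ⟶ y)

end Quiver

/-- `HasChain le d`: there is a totally ordered subset with exactly `d` elements. -/
def HasChain {X : Type u} (le : X → X → Prop) (d : ℕ) : Prop :=
  ∃ s : Finset X, IsChain le (s : Set X) ∧ s.card = d

/-! ### The path algebra -/

/-- The path algebra `kQ`: the vector space with basis all paths, including the trivial ones;
the product of two basis elements is the concatenation of the paths, or zero. -/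
def PathAlgebra (k : Type w) (V : Type u) [Quiver.{v} V] [Field k] : Type (max u v w) :=
  (Σ a b : V, Quiver.Path a b) →₀ k

namespace PathAlgebra

variable (k : Type w) (V : Type u) [Quiver.{v} V] [Field k]

noncomputable instance : AddCommGroup (PathAlgebra k V) :=
  inferInstanceAs (AddCommGroup ((Σ a b : V, Quiver.Path a b) →₀ k))

noncomputable instance : Module k (PathAlgebra k V) :=
  inferInstanceAs (Module k ((Σ a b : V, Quiver.Path a b) →₀ k))

variable {V}

/-- The basis element of a path. -/
noncomputable def ofPath (p : Σ a b : V, Quiver.Path a b) : PathAlgebra k V :=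
  Finsupp.single p (1 : k)

variable (V) in
/-- The basis of all paths. -/
noncomputable def pathBasis : Module.Basis (Σ a b : V, Quiver.Path a b) k (PathAlgebra k V) :=
  ⟨LinearEquiv.refl k ((Σ a b : V, Quiver.Path a b) →₀ k)⟩

theorem pathBasis_apply (p : Σ a b : V, Quiver.Path a b) : pathBasis k V p = ofPath k p := rfl

open Classical in
/-- The product of two basis elements. -/
noncomputable def pathMul : (p q : Σ a b : V, Quiver.Path a b) → PathAlgebra k V
  | ⟨a, b, p⟩, ⟨c, d, q⟩ =>
    if h : c = b then ofPath k ⟨a, d, p.comp (h ▸ q)⟩ else 0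

theorem pathMul_comp {a b c : V} (p : Quiver.Path a b) (q : Quiver.Path b c) :
    pathMul k ⟨a, b, p⟩ ⟨b, c, q⟩ = ofPath k ⟨a, c, p.comp q⟩ := by
  simp [pathMul]

theorem pathMul_of_ne {a b c d : V} (p : Quiver.Path a b) (q : Quiver.Path c d) (h : c ≠ b) :
    pathMul k ⟨a, b, p⟩ ⟨c, d, q⟩ = 0 := by
  simp [pathMul, h]

variable (V) in
/-- Multiplication, extended bilinearly from the basis. -/
noncomputable def mulLin : PathAlgebra k V →ₗ[k] PathAlgebra k V →ₗ[k] PathAlgebra k V :=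
  (pathBasis k V).constr k fun p => (pathBasis k V).constr k fun q => pathMul k p q

theorem mulLin_ofPath (p q : Σ a b : V, Quiver.Path a b) :
    mulLin k V (ofPath k p) (ofPath k q) = pathMul k p q := by
  simp only [mulLin, ← pathBasis_apply, Module.Basis.constr_basis]

noncomputable instance : Mul (PathAlgebra k V) := ⟨fun x y => mulLin k V x y⟩

/-- The unit is the sum of the trivial paths. -/
noncomputable instance [Fintype V] : One (PathAlgebra k V) :=
  ⟨∑ a : V, ofPath k ⟨a, a, Quiver.Path.nil⟩⟩

theorem mul_def (x y : PathAlgebra k V) : x * y = mulLin k V x y := rfl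

theorem one_def [Fintype V] :
    (1 : PathAlgebra k V) = ∑ a : V, ofPath k ⟨a, a, Quiver.Path.nil⟩ := rfl

theorem ofPath_mul_ofPath {a b c : V} (p : Quiver.Path a b) (q : Quiver.Path b c) :
    ofPath k ⟨a, b, p⟩ * ofPath k ⟨b, c, q⟩ = ofPath k ⟨a, c, p.comp q⟩ := by
  rw [mul_def, mulLin_ofPath, pathMul_comp]

theorem ofPath_mul_ofPath_of_ne {a b c d : V} (p : Quiver.Path a b) (q : Quiver.Path c d)
    (h : c ≠ b) : ofPath k ⟨a, b, p⟩ * ofPath k ⟨c, d, q⟩ = 0 := by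
  rw [mul_def, mulLin_ofPath, pathMul_of_ne k p q h]

theorem induction {P : PathAlgebra k V → Prop} (x : PathAlgebra k V) (h0 : P 0)
    (hadd : ∀ x y, P x → P y → P (x + y)) (hs : ∀ (c : k) p, P (c • ofPath k p)) : P x := by
  have hx : x ∈ Submodule.span k (Set.range (pathBasis k V)) := by
    rw [(pathBasis k V).span_eq]; trivial
  induction hx using Submodule.span_induction with
  | mem y hy => obtain ⟨p, rfl⟩ := hy; simpa [pathBasis_apply] using hs 1 p
  | zero => exact h0
  | add y z _ _ hy hz => exact hadd y z hy hz
  | smul c y _ _ =>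
    rw [← (pathBasis k V).linearCombination_repr (c • y), Finsupp.linearCombination_apply]
    exact Finset.sum_induction _ P hadd h0 fun p _ => hs _ p

theorem mulLin_assoc (x y z : PathAlgebra k V) :
    mulLin k V (mulLin k V x y) z = mulLin k V x (mulLin k V y z) := by
  induction x using induction with
  | h0 => simp
  | hadd x x' hx hx' => simp [hx, hx']
  | hs r p =>
  induction y using induction with
  | h0 => simp
  | hadd y y' hy hy' => simp only [map_add, LinearMap.add_apply, hy, hy']
  | hs s q =>
  induction z using induction with
  | h0 => simp
  | hadd z z' hz hz' => simp only [map_add, hz, hz']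
  | hs t s =>
  obtain ⟨a, b, p⟩ := p
  obtain ⟨c, d, q⟩ := q
  obtain ⟨e, f, s⟩ := s
  simp only [map_smul, LinearMap.smul_apply, mulLin_ofPath]
  by_cases h₁ : c = b
  · subst h₁
    by_cases h₂ : e = d
    · subst h₂
      simp only [pathMul_comp, mulLin_ofPath, Quiver.Path.comp_assoc]
    · simp only [pathMul_comp, mulLin_ofPath, pathMul_of_ne k _ _ h₂, map_zero, smul_zero]
  · by_cases h₂ : e = d
    · subst h₂
      simp only [pathMul_comp, mulLin_ofPath, pathMul_of_ne k _ _ h₁, map_zero, smul_zero,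
        LinearMap.zero_apply]
    · simp only [pathMul_of_ne k _ _ h₁, pathMul_of_ne k _ _ h₂, map_zero, smul_zero,
        LinearMap.zero_apply]

theorem mulLin_one_left [Fintype V] (x : PathAlgebra k V) : mulLin k V 1 x = x := by
  induction x using induction with
  | h0 => simp
  | hadd x x' hx hx' => simp [hx, hx']
  | hs r p =>
  obtain ⟨a, b, p⟩ := p
  rw [map_smul, one_def, map_sum, LinearMap.sum_apply, Finset.sum_eq_single a]
  · rw [mulLin_ofPath, pathMul_comp, Quiver.Path.nil_comp]
  · intro c _ hc
    rw [mulLin_ofPath, pathMul_of_ne k _ _ hc.symm]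
  · simp

theorem mulLin_one_right [Fintype V] (x : PathAlgebra k V) : mulLin k V x 1 = x := by
  induction x using induction with
  | h0 => simp
  | hadd x x' hx hx' => simp [hx, hx']
  | hs r p =>
  obtain ⟨a, b, p⟩ := p
  rw [map_smul, LinearMap.smul_apply, one_def, map_sum, Finset.sum_eq_single b]
  · rw [mulLin_ofPath, pathMul_comp, Quiver.Path.comp_nil]
  · intro c _ hc
    rw [mulLin_ofPath, pathMul_of_ne k _ _ hc]
  · simp

noncomputable instance [Fintype V] : Ring (PathAlgebra k V) where
  __ := (inferInstance : AddCommGroup (PathAlgebra k V))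
  left_distrib x y z := map_add (mulLin k V x) y z
  right_distrib x y z := by simp only [mul_def, map_add, LinearMap.add_apply]
  zero_mul x := by simp only [mul_def, map_zero, LinearMap.zero_apply]
  mul_zero x := map_zero (mulLin k V x)
  mul_assoc := mulLin_assoc k
  one_mul := mulLin_one_left k
  mul_one := mulLin_one_right k

noncomputable instance [Fintype V] : Algebra k (PathAlgebra k V) :=
  Algebra.ofModule
    (fun r x y => by simp only [mul_def, map_smul, LinearMap.smul_apply])
    (fun r x y => by simp only [mul_def, map_smul])

end PathAlgebra

/-- The Gelfand–Kirillov dimension of a `k`-algebra `A`: the supremum, over all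
finite-dimensional subspaces `W`, of `limsup log (dim (W⁰ + W¹ + ⋯ + Wⁿ)) / log n`. -/
noncomputable def gkDim (k : Type w) (A : Type u) [Field k] [Ring A] [Algebra k A] : EReal :=
  ⨆ (W : Submodule k A) (_ : W.FG),
    Filter.limsup (fun n : ℕ =>
      ((Real.log (Module.finrank k ↥(∑ i ∈ Finset.range (n + 1), W ^ i)) / Real.log n : ℝ) :
        EReal)) Filter.atTop

/-! Finite dimension forces every strong component with a closed path to be a single cycle
(`ExclusiveCycles`): two different arrows of one component with a common target give two ways of
returning to it, and the path count grows exponentially. When the components are cycles, `≼` on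
simple cycles is reachability between components. An Ext-quiver arrow inside one component has
length a multiple of the cycle length, so it ends where it starts; distinct comparable vertices
therefore lie in distinct components. Conversely, vertices of successive cyclic components can be
shifted along their cycles until the connecting lengths become divisible
(`IsStrictChain.exists_extArrow`). Hence both orders have chains of the same sizes as
`IsStrictChain`. For the dimension, paths are counted by splitting off the last arrow. Each further
cycle that can be traversed raises the degree of growth by one: `choose_succ_le_pathCount` is the
lower bound, by Pascal's rule, and `ExclusiveCycles.pathCount_le` the upper bound of the same
degree. `le_gkDim_of_choose_le_pathCount` and `gkDim_le_of_pathCount_le` pass from counts to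
`gkDim`. -/

namespace Quiver

variable {V : Type*} [Quiver V]

/-! ### Reachability and closed paths -/

theorem Path.reachable_of_mem_vertices {a b x : V} (p : Path a b) (hx : x ∈ p.vertices) :
    Reachable a x ∧ Reachable x b := by
  obtain ⟨p₁, p₂, -⟩ := p.exists_eq_comp_of_mem_vertices hx
  exact ⟨⟨p₁⟩, ⟨p₂⟩⟩

/-- A closed path can be rotated to start at any of its vertices. -/
theorem Path.exists_rotate {a x : V} (p : Path a a) (hx : x ∈ p.vertices) :
    ∃ q : Path x x, q.length = p.length := by
  obtain ⟨p₁, p₂, rfl⟩ := p.exists_eq_comp_of_mem_vertices hx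
  exact ⟨p₂.comp p₁, by simp only [length_comp]; omega⟩

theorem Path.exists_length_mul {x : V} (p : Path x x) (n : ℕ) :
    ∃ q : Path x x, q.length = n * p.length := by
  induction n with
  | zero => exact ⟨.nil, by simp⟩
  | succ n ih =>
    obtain ⟨q, hq⟩ := ih
    exact ⟨q.comp p, by rw [length_comp, hq, Nat.succ_mul]⟩

theorem Path.exists_arrow_right_eq {a b x : V} (p : Path a b) (hx : x ∈ p.vertices)
    (hxa : x ≠ a) : ∃ e ∈ p.arrows, e.right = x := by
  induction p with
  | nil => simp at hx; exact absurd hx hxa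
  | cons p e ih =>
    rcases (mem_vertices_cons p e).1 hx with h | rfl
    · obtain ⟨f, hf, rfl⟩ := ih h
      exact ⟨f, List.mem_append_left _ hf, rfl⟩
    · exact ⟨⟨_, _, e⟩, by simp [arrows], rfl⟩

/-- Every vertex of a closed path of positive length is the target of one of its arrows. -/
theorem Path.exists_arrow_right_eq_of_closed {a x : V} (p : Path a a) (hp : 0 < p.length)
    (hx : x ∈ p.vertices) : ∃ e ∈ p.arrows, e.right = x := by
  by_cases hxa : x = a
  · subst hxa
    cases p with
    | nil => simp at hp
    | cons p e => exact ⟨⟨_, _, e⟩, by simp [arrows], rfl⟩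
  · exact p.exists_arrow_right_eq hx hxa

theorem Reachable.exists_isSimpleChain {a b : V} (h : Reachable a b) :
    ∃ p : Path a b, p.IsSimpleChain := by
  obtain ⟨p⟩ := h
  induction p with
  | nil => exact ⟨.nil, by simp [Path.IsSimpleChain]⟩
  | @cons c b p e ih =>
    obtain ⟨q, hq⟩ := ih
    by_cases hb : b ∈ q.vertices
    -- Loop erasure: the end point was already visited, so the chain is cut there.
    · obtain ⟨q₁, q₂, rfl⟩ := q.exists_eq_comp_of_mem_vertices hb
      refine ⟨q₁, ?_⟩
      rw [Path.IsSimpleChain, Path.vertices_comp] at hq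
      rw [Path.IsSimpleChain, ← q₁.dropLast_append_end_eq]
      refine hq.sublist (List.Sublist.append_left ?_ _)
      simpa using q₂.start_mem_vertices
    · refine ⟨q.cons e, ?_⟩
      simp only [Path.IsSimpleChain, Path.vertices_cons, List.concat_eq_append]
      exact List.Nodup.append hq (List.nodup_singleton _) (by simpa using hb)

/-- A vertex lying on a closed path of positive length. -/
def OnClosedPath (x : V) : Prop := ∃ p : Path x x, 0 < p.length

theorem OnClosedPath.exists_isSimpleCycle {x : V} (h : OnClosedPath x) :
    ∃ p : Path x x, p.IsSimpleCycle := by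
  obtain ⟨p, hp⟩ := h
  cases p with
  | nil => simp at hp
  | cons p e =>
    obtain ⟨q, hq⟩ := Reachable.exists_isSimpleChain ⟨p⟩
    exact ⟨q.cons e, by simp, by simpa [Path.IsSimpleChain] using hq⟩

theorem Path.isChain_of_dropLast_nodup {a b : V} (p : Path a b)
    (h : p.vertices.dropLast.Nodup) : p.IsChain := by
  -- A repeated arrow would repeat its source.
  have key : ∀ {b : V} (p : Path a b), p.arrows.map Total.left = p.vertices.dropLast := by
    intro b p
    induction p with
    | nil => simp [arrows]
    | cons p e ih => simp [arrows, ih]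
  exact List.Nodup.of_map Total.left (by rwa [key])

theorem isCyclicVertex_iff {x : V} : IsCyclicVertex x ↔ OnClosedPath x := by
  constructor
  · rintro ⟨a, p, ⟨hp, -⟩, hx⟩
    obtain ⟨q, hq⟩ := p.exists_rotate hx
    exact ⟨q, hq ▸ hp⟩
  · intro h
    obtain ⟨p, hp⟩ := h.exists_isSimpleCycle
    exact ⟨x, p, ⟨hp.1, p.isChain_of_dropLast_nodup hp.2⟩, p.start_mem_vertices⟩

theorem OnClosedPath.of_reachable {x y : V} (h : OnClosedPath x) (hxy : Reachable x y)
    (hyx : Reachable y x) : OnClosedPath y := by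
  obtain ⟨p, hp⟩ := h
  obtain ⟨q⟩ := hxy
  obtain ⟨r⟩ := hyx
  exact ⟨(r.comp p).comp q, by simp only [Path.length_comp]; omega⟩

/-- From a vertex on a closed path one can walk any number of steps without losing the
possibility of coming back. -/
theorem OnClosedPath.exists_path_length {x : V} (h : OnClosedPath x) (n : ℕ) :
    ∃ (y : V) (p : Path x y), p.length = n ∧ Reachable y x := by
  obtain ⟨p, hp⟩ := h
  obtain ⟨q, hq⟩ := p.exists_length_mul n
  have hn : n ≤ q.length := hq ▸ Nat.le_mul_of_pos_right n hp
  obtain ⟨y, q₁, q₂, -, h₁⟩ := q.exists_eq_comp_of_le_length hn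
  exact ⟨y, q₁, h₁, ⟨q₂⟩⟩

/-! ### Quivers whose strong components are cycles -/

variable (V) in
/-- Every vertex is the target of at most one arrow of its strong component: the strong
components are isolated vertices or cycles. -/
def ExclusiveCycles : Prop :=
  ∀ ⦃a a' b : V⦄ (e : a ⟶ b) (e' : a' ⟶ b), Reachable b a → Reachable b a' →
    (⟨a, b, e⟩ : Total V) = ⟨a', b, e'⟩

namespace ExclusiveCycles

variable (hV : ExclusiveCycles V)
include hV

/-- Traced backwards from `y`, the path `r` can never leave `p`: its last arrow and the arrow of `p`
into the same vertex both lie in the strong component, so they coincide. -/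
theorem mem_vertices_of_path {a x y : V} (p : Path a a) (hp : 0 < p.length) (r : Path x y)
    (hy : y ∈ p.vertices) (hyx : Reachable y x) : x ∈ p.vertices := by
  induction r with
  | nil => exact hy
  | @cons z y r e ih =>
    obtain ⟨⟨w, y', f⟩, hf, h⟩ := p.exists_arrow_right_eq_of_closed hp hy
    obtain rfl : y' = y := h
    have hw := p.left_mem_vertices _ hf
    have := hV e f (hyx.trans ⟨r⟩)
      ((p.reachable_of_mem_vertices hy).2.trans (p.reachable_of_mem_vertices hw).1)
    obtain rfl : z = w := congrArg Total.left this
    exact ih hw (e.reachable.trans hyx)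

theorem mem_vertices_iff {a x : V} (p : Path a a) (hp : 0 < p.length) :
    x ∈ p.vertices ↔ Reachable a x ∧ Reachable x a :=
  ⟨p.reachable_of_mem_vertices, fun ⟨h, ⟨r⟩⟩ =>
    hV.mem_vertices_of_path p hp r p.start_mem_vertices h⟩

theorem mem_arrows_iff {a : V} (p : Path a a) (hp : 0 < p.length) (e : Total V) :
    e ∈ p.arrows ↔ e.left ∈ p.vertices ∧ e.right ∈ p.vertices := by
  refine ⟨fun h => ⟨p.left_mem_vertices e h, p.right_mem_vertices e h⟩, fun ⟨hl, hr⟩ => ?_⟩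
  obtain ⟨x, y, e⟩ := e
  obtain ⟨⟨w, y', f⟩, hf, h⟩ := p.exists_arrow_right_eq_of_closed hp hr
  obtain rfl : y' = y := h
  have hy := (p.reachable_of_mem_vertices hr).2
  rwa [hV e f (hy.trans (p.reachable_of_mem_vertices hl).1)
    (hy.trans (p.reachable_of_mem_vertices (p.left_mem_vertices _ hf)).1)]

/-- Each closed path of positive length uses all vertices and all arrows of its strong component. -/
theorem subquiver_eq {a b : V} (p : Path a a) (q : Path b b) (hp : 0 < p.length)
    (hq : 0 < q.length) (hab : Reachable a b) (hba : Reachable b a) :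
    p.subquiver = q.subquiver := by
  have hv : ∀ x, x ∈ p.vertices ↔ x ∈ q.vertices := fun x => by
    rw [hV.mem_vertices_iff p hp, hV.mem_vertices_iff q hq]
    exact ⟨fun h => ⟨hba.trans h.1, h.2.trans hab⟩, fun h => ⟨hab.trans h.1, h.2.trans hba⟩⟩
  refine Subquiver.ext (Set.ext hv) (Set.ext fun e => ?_)
  change e ∈ p.arrows ↔ e ∈ q.arrows
  rw [hV.mem_arrows_iff p hp, hV.mem_arrows_iff q hq, hv, hv]

/-- Paths inside a strong component are determined by their end point and their length. -/
theorem eq_of_length_eq {x x' y : V} (p : Path x y) (q : Path x' y) (hx : Reachable y x)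
    (hx' : Reachable y x') (h : p.length = q.length) : x = x' := by
  induction p with
  | nil => exact q.eq_of_length_zero (by simpa using h.symm) |>.symm
  | @cons z y p e ih =>
    cases q with
    | nil => simp at h
    | @cons w _ q f =>
      obtain rfl : z = w := congrArg Total.left (hV e f (hx.trans ⟨p⟩) (hx'.trans ⟨q⟩))
      exact ih q (e.reachable.trans hx) (e.reachable.trans hx') (by simpa using h)

end ExclusiveCycles

/-! ### The order on the simple cycles -/

namespace SimpleCycles

theorem reachable_of_mem (C : SimpleCycles V) {x y : V} (hx : x ∈ C.1.verts)
    (hy : y ∈ C.1.verts) : Reachable x y := by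
  obtain ⟨C, a, p, hp, rfl⟩ := C
  exact (p.reachable_of_mem_vertices hx).2.trans (p.reachable_of_mem_vertices hy).1

theorem nonempty_verts (C : SimpleCycles V) : ∃ x, x ∈ C.1.verts := by
  obtain ⟨C, a, p, hp, rfl⟩ := C
  exact ⟨a, p.start_mem_vertices⟩

theorem onClosedPath_of_mem (C : SimpleCycles V) {x : V} (hx : x ∈ C.1.verts) :
    OnClosedPath x := by
  obtain ⟨C, a, p, hp, rfl⟩ := C
  obtain ⟨q, hq⟩ := p.exists_rotate hx
  exact ⟨q, hq ▸ hp.1⟩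

/-- Loop erasure turns any path into a simple chain, and a cycle is strongly connected, so the
choice of vertices is immaterial. -/
theorem le_iff {C₁ C₂ : SimpleCycles V} {x y : V} (hx : x ∈ C₁.1.verts) (hy : y ∈ C₂.1.verts) :
    C₁.le C₂ ↔ Reachable x y := by
  constructor
  · rintro (⟨a, ha, b, hb, p, -⟩ | ⟨a, ha, hb⟩)
    · exact (C₁.reachable_of_mem hx ha).trans (Reachable.trans ⟨p⟩ (C₂.reachable_of_mem hb hy))
    · exact (C₁.reachable_of_mem hx ha).trans (C₂.reachable_of_mem hb hy)
  · exact fun h => Or.inl ⟨x, hx, y, hy, h.exists_isSimpleChain⟩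

theorem le_antisymm (hV : ExclusiveCycles V) {C₁ C₂ : SimpleCycles V} (h₁ : C₁.le C₂)
    (h₂ : C₂.le C₁) : C₁ = C₂ := by
  obtain ⟨C₁, a, p, hp, rfl⟩ := C₁
  obtain ⟨C₂, b, q, hq, rfl⟩ := C₂
  exact Subtype.ext (hV.subquiver_eq p q hp.1 hq.1
    ((le_iff p.start_mem_vertices q.start_mem_vertices).1 h₁)
    ((le_iff q.start_mem_vertices p.start_mem_vertices).1 h₂))

theorem isPartialOrder (hV : ExclusiveCycles V) :
    IsPartialOrder (SimpleCycles V) SimpleCycles.le where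
  refl C := by
    obtain ⟨x, hx⟩ := C.nonempty_verts
    exact (le_iff hx hx).2 .rfl
  trans C₁ C₂ C₃ h₁ h₂ := by
    obtain ⟨x, hx⟩ := C₁.nonempty_verts
    obtain ⟨y, hy⟩ := C₂.nonempty_verts
    obtain ⟨z, hz⟩ := C₃.nonempty_verts
    exact (le_iff hx hz).2 (((le_iff hx hy).1 h₁).trans ((le_iff hy hz).1 h₂))
  antisymm C₁ C₂ h₁ h₂ := le_antisymm hV h₁ h₂

end SimpleCycles

/-! ### The order on the Ext-quiver -/

/-- There is a path from `x` to `y` whose length is a positive multiple of the product of the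
lengths of simple cycles through `x` and `y`. -/
def ExtArrow (x y : V) : Prop :=
  ∃ (a b : V) (p : Path a a) (q : Path b b),
    p.IsSimpleCycle ∧ x ∈ p.vertices ∧ q.IsSimpleCycle ∧ y ∈ q.vertices ∧
    ∃ (r : Path x y) (l : ℕ), 0 < l ∧ r.length = l * (p.length * q.length)

theorem ExtArrow.reachable {x y : V} (h : ExtArrow x y) : Reachable x y := by
  obtain ⟨a, b, p, q, -, -, -, -, r, -⟩ := h
  exact ⟨r⟩

theorem ExtArrow.trans {x y z : V} (h₁ : ExtArrow x y) (h₂ : ExtArrow y z) : ExtArrow x z := by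
  obtain ⟨a, b, p, q, hp, hx, hq, hy, r, l, hl, hr⟩ := h₁
  obtain ⟨a', b', p', q', hp', hy', hq', hz, r', l', hl', hr'⟩ := h₂
  obtain ⟨c, hc⟩ := p.exists_rotate hx
  obtain ⟨c', hc'⟩ := q'.exists_rotate hz
  -- Extra turns at both ends repair divisibility: those at `x` multiply the length of `r` by
  -- `q'.length`, those at `z` multiply the length of `r'` by `p.length`.
  obtain ⟨s, hs⟩ := c.exists_length_mul (l * q.length * (q'.length - 1))
  obtain ⟨s', hs'⟩ := c'.exists_length_mul (l' * p'.length * (p.length - 1))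
  refine ⟨a, b', p, q', hp, hx, hq', hz, (s.comp r).comp (r'.comp s'),
    l * q.length + l' * p'.length, by have := Nat.mul_pos hl hq.1; omega, ?_⟩
  simp only [Path.length_comp, hr, hr', hs, hs', hc, hc']
  obtain ⟨n, hn⟩ : ∃ n, p.length = n + 1 := ⟨p.length - 1, by have := hp.1; omega⟩
  obtain ⟨m, hm⟩ : ∃ m, q'.length = m + 1 := ⟨q'.length - 1, by have := hq'.1; omega⟩
  rw [hn, hm, Nat.add_sub_cancel, Nat.add_sub_cancel]
  ring

/-- Winding around the cycle at `y` gives a closed path of the same length as `r`; inside a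
component, end point and length determine the start. -/
theorem ExtArrow.eq_of_reachable (hV : ExclusiveCycles V) {x y : V} (h : ExtArrow x y)
    (hyx : Reachable y x) : x = y := by
  obtain ⟨a, b, p, q, hp, hx, hq, hy, r, l, hl, hr⟩ := h
  obtain ⟨c, hc⟩ := q.exists_rotate hy
  obtain ⟨s, hs⟩ := c.exists_length_mul (l * p.length)
  exact hV.eq_of_length_eq r s hyx .rfl (by rw [hr, hs, hc, mul_assoc])

/-- A path ending on a cycle can be prolonged along that cycle to yield an arrow of the
Ext-quiver. -/
theorem exists_extArrow (hV : ExclusiveCycles V) {x z : V} (hx : OnClosedPath x)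
    (hz : OnClosedPath z) (h : Reachable x z) :
    ∃ y, Reachable z y ∧ Reachable y z ∧ ExtArrow x y := by
  obtain ⟨r⟩ := h
  obtain ⟨p, hp⟩ := hx.exists_isSimpleCycle
  obtain ⟨q, hq⟩ := hz.exists_isSimpleCycle
  have hpos : 0 < p.length * q.length := Nat.mul_pos hp.1 hq.1
  -- With `N = p.length * q.length`, these steps bring the total to `(r.length + 1) * N`; the last
  -- summand `N` keeps the multiplier positive when `r` is trivial.
  obtain ⟨y, s, hs, hyz⟩ := hz.exists_path_length
    (r.length * (p.length * q.length - 1) + p.length * q.length)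
  refine ⟨y, ⟨s⟩, hyz, x, z, p, q, hp, p.start_mem_vertices, hq,
    (hV.mem_vertices_iff q hq.1).2 ⟨⟨s⟩, hyz⟩, r.comp s, r.length + 1, Nat.succ_pos _, ?_⟩
  rw [Path.length_comp, hs]
  obtain ⟨n, hn⟩ : ∃ n, p.length * q.length = n + 1 := ⟨_, (Nat.sub_add_cancel hpos).symm⟩
  rw [hn, Nat.add_sub_cancel]
  ring

namespace ExtQuiver

theorem le_iff {x y : ExtQuiver V} : x.le y ↔ x = y ∨ ExtArrow x.1 y.1 :=
  or_congr_right ⟨fun ⟨⟨h⟩⟩ => h, fun h => ⟨⟨h⟩⟩⟩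

theorem isPartialOrder (hV : ExclusiveCycles V) : IsPartialOrder (ExtQuiver V) ExtQuiver.le where
  refl _ := Or.inl rfl
  trans x y z h₁ h₂ := by
    rw [le_iff] at *
    rcases h₁ with rfl | h₁
    · exact h₂
    · rcases h₂ with rfl | h₂
      · exact Or.inr h₁
      · exact Or.inr (h₁.trans h₂)
  antisymm x y h₁ h₂ := by
    rw [le_iff] at *
    rcases h₁ with rfl | h₁
    · rfl
    · rcases h₂ with rfl | h₂
      · rfl
      · exact Subtype.ext (h₁.eq_of_reachable hV h₂.reachable)

end ExtQuiver

/-! ### Chains of strong components -/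

/-- `y` is reachable from `x`, but not conversely. -/
def StrictReach (x y : V) : Prop := Reachable x y ∧ ¬ Reachable y x

theorem StrictReach.ne {x y : V} (h : StrictReach x y) : x ≠ y := by
  rintro rfl
  exact h.2 .rfl

/-- Vertices on closed paths of pairwise distinct strong components that are totally ordered by
reachability. -/
def IsStrictChain (s : Finset V) : Prop :=
  (∀ x ∈ s, OnClosedPath x) ∧ IsChain StrictReach (s : Set V)

theorem IsStrictChain.subset {s t : Finset V} (h : IsStrictChain s) (hts : t ⊆ s) :
    IsStrictChain t :=
  ⟨fun x hx => h.1 x (hts hx), h.2.mono (by exact_mod_cast hts)⟩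

section Fintype

variable [Fintype V]

open Classical in
/-- The number of vertices from which `x` can be reached. -/
noncomputable def ancestorCount (x : V) : ℕ := (Finset.univ.filter fun y => Reachable y x).card

theorem ancestorCount_le_card (x : V) : ancestorCount x ≤ Fintype.card V :=
  Finset.card_le_univ _

theorem ancestorCount_mono {x y : V} (h : Reachable x y) : ancestorCount x ≤ ancestorCount y :=
  Finset.card_le_card fun z hz => by
    simp only [Finset.mem_filter, Finset.mem_univ, true_and] at *
    exact hz.trans h

theorem StrictReach.ancestorCount_lt {x y : V} (h : StrictReach x y) :
    ancestorCount x < ancestorCount y := by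
  refine Finset.card_lt_card (Finset.ssubset_iff_of_subset (fun z hz => ?_) |>.2 ⟨y, ?_, ?_⟩)
  · simp only [Finset.mem_filter, Finset.mem_univ, true_and] at *
    exact hz.trans h.1
  · simp [Reachable.rfl]
  · simpa using h.2

/-- `ancestorCount` increases strictly along the chain, so its maximum is the top. -/
theorem IsStrictChain.exists_top {s : Finset V} (h : IsStrictChain s) (hs : s.Nonempty) :
    ∃ z ∈ s, ∀ x ∈ s, x ≠ z → StrictReach x z := by
  obtain ⟨z, hz, hmax⟩ := s.exists_max_image ancestorCount hs
  refine ⟨z, hz, fun x hx hxz => ?_⟩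
  rcases h.2 hx hz hxz with h | h
  · exact h
  · exact absurd h.ancestorCount_lt (hmax x hx).not_gt

/-- The vertices of a strict chain can be moved inside their strong components so that they
become connected by arrows of the Ext-quiver. -/
theorem IsStrictChain.exists_extArrow (hV : ExclusiveCycles V) {s : Finset V}
    (h : IsStrictChain s) :
    ∃ f : V → V, (∀ x, Reachable x (f x) ∧ Reachable (f x) x) ∧
      ∀ x ∈ s, ∀ y ∈ s, StrictReach x y → ExtArrow (f x) (f y) := by
  classical
  induction hn : s.card generalizing s with
  | zero =>
    obtain rfl := Finset.card_eq_zero.1 hn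
    exact ⟨id, fun x => ⟨.rfl, .rfl⟩, by simp⟩
  | succ n ih =>
    obtain ⟨z, hz, htop⟩ := h.exists_top (Finset.card_pos.1 (by omega))
    have hs' := h.subset (s.erase_subset z)
    obtain ⟨f, hf, harr⟩ := ih hs' (by rw [Finset.card_erase_of_mem hz, hn]; rfl)
    have key : ∃ y, Reachable z y ∧ Reachable y z ∧ ∀ x ∈ s.erase z, ExtArrow (f x) y := by
      rcases (s.erase z).eq_empty_or_nonempty with h0 | hne
      · exact ⟨z, .rfl, .rfl, by simp [h0]⟩
      obtain ⟨w, hw, hwtop⟩ := hs'.exists_top hne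
      have hwz := htop w (Finset.mem_of_mem_erase hw) (Finset.ne_of_mem_erase hw)
      -- Only the arrow from the moved second largest vertex `f w` has to be arranged; the others
      -- follow by transitivity.
      obtain ⟨y, hzy, hyz, hy⟩ := Quiver.exists_extArrow hV
        ((hs'.1 w hw).of_reachable (hf w).1 (hf w).2) (h.1 z hz) ((hf w).2.trans hwz.1)
      refine ⟨y, hzy, hyz, fun x hx => ?_⟩
      by_cases hxw : x = w
      · rwa [hxw]
      · exact (harr x hx w hw (hwtop x hx hxw)).trans hy
    obtain ⟨y, hzy, hyz, hy⟩ := key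
    refine ⟨Function.update f z y, fun x => ?_, fun a ha b hb hab => ?_⟩
    · by_cases hx : x = z
      · subst hx
        simpa using ⟨hzy, hyz⟩
      · simpa [hx] using hf x
    · have haz : a ≠ z := by
        rintro rfl
        exact hab.2 (htop b hb hab.ne.symm).1
      by_cases hbz : b = z
      · subst hbz
        simpa [haz] using hy a (Finset.mem_erase.2 ⟨haz, ha⟩)
      · simpa [haz, hbz] using harr a (Finset.mem_erase.2 ⟨haz, ha⟩) b
          (Finset.mem_erase.2 ⟨hbz, hb⟩) hab

end Fintype

end Quiver

/-- Transport of chains along a map that preserves the relation between distinct elements of the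
chain and is injective there. -/
theorem IsChain.exists_finset_image {X Y : Type*} {r : X → X → Prop} {r' : Y → Y → Prop}
    {s : Finset X} (hs : IsChain r (s : Set X)) (f : X → Y)
    (hf : ∀ x ∈ s, ∀ y ∈ s, x ≠ y → r x y → r' (f x) (f y) ∧ f x ≠ f y) :
    ∃ t : Finset Y, IsChain r' (t : Set Y) ∧ t.card = s.card ∧ ∀ y ∈ t, ∃ x ∈ s, f x = y := by
  classical
  have hne : ∀ x ∈ s, ∀ y ∈ s, x ≠ y → f x ≠ f y := fun x hx y hy hxy => by
    rcases hs hx hy hxy with h | h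
    · exact (hf x hx y hy hxy h).2
    · exact (hf y hy x hx hxy.symm h).2.symm
  refine ⟨s.image f, ?_, Finset.card_image_of_injOn fun x hx y hy hxy => ?_, by simp⟩
  · intro a ha b hb hab
    simp only [Finset.coe_image, Set.mem_image, Finset.mem_coe] at ha hb
    obtain ⟨x, hx, rfl⟩ := ha
    obtain ⟨y, hy, rfl⟩ := hb
    have hxy : x ≠ y := fun h => hab (by rw [h])
    exact (hs hx hy hxy).imp (fun h => (hf x hx y hy hxy h).1)
      fun h => (hf y hy x hx hxy.symm h).1
  · by_contra h
    exact hne x hx y hy h hxy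

/-! ### Chains in the two orders and strict chains of vertices -/

namespace Quiver

variable {V : Type*} [Quiver V]

theorem hasChain_simpleCycles_iff (hV : ExclusiveCycles V) (d : ℕ) :
    HasChain (SimpleCycles.le (V := V)) d ↔ ∃ s : Finset V, IsStrictChain s ∧ s.card = d := by
  constructor
  · rintro ⟨s, hs, rfl⟩
    choose f hf using SimpleCycles.nonempty_verts (V := V)
    obtain ⟨t, ht, hcard, hmem⟩ := hs.exists_finset_image (r' := StrictReach) f
      fun C₁ _ C₂ _ hne h => by
        have : StrictReach (f C₁) (f C₂) := ⟨(SimpleCycles.le_iff (hf _) (hf _)).1 h, fun h' =>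
          hne (SimpleCycles.le_antisymm hV h ((SimpleCycles.le_iff (hf _) (hf _)).2 h'))⟩
        exact ⟨this, this.ne⟩
    refine ⟨t, ⟨fun x hx => ?_, ht⟩, hcard⟩
    obtain ⟨C, -, rfl⟩ := hmem x hx
    exact C.onClosedPath_of_mem (hf C)
  · rintro ⟨s, hs, rfl⟩
    -- There may be no simple cycle at all; a nonempty `s` supplies one as the value of `f` outside
    -- `s`.
    rcases s.eq_empty_or_nonempty with rfl | ⟨x₀, hx₀⟩
    · exact ⟨∅, by simp, rfl⟩
    have : ∃ f : V → SimpleCycles V, ∀ x ∈ s, x ∈ (f x).1.verts := by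
      have : ∀ x, ∃ C : SimpleCycles V, x ∈ s → x ∈ C.1.verts := fun x => by
        obtain ⟨p₀, hp₀⟩ := (hs.1 x₀ hx₀).exists_isSimpleCycle
        by_cases hx : x ∈ s
        · obtain ⟨p, hp⟩ := (hs.1 x hx).exists_isSimpleCycle
          exact ⟨⟨_, x, p, hp, rfl⟩, fun _ => p.start_mem_vertices⟩
        · exact ⟨⟨_, x₀, p₀, hp₀, rfl⟩, fun h => absurd h hx⟩
      choose f hf using this
      exact ⟨f, hf⟩
    obtain ⟨f, hf⟩ := this
    obtain ⟨t, ht, hcard, -⟩ := hs.2.exists_finset_image (r' := SimpleCycles.le) f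
      fun x hx y hy _ h => ⟨(SimpleCycles.le_iff (hf x hx) (hf y hy)).2 h.1, fun he =>
        h.2 ((f x).reachable_of_mem (he ▸ hf y hy) (hf x hx))⟩
    exact ⟨t, ht, hcard⟩

theorem hasChain_extQuiver_iff [Fintype V] (hV : ExclusiveCycles V) (d : ℕ) :
    HasChain (ExtQuiver.le (V := V)) d ↔ ∃ s : Finset V, IsStrictChain s ∧ s.card = d := by
  constructor
  · rintro ⟨s, hs, rfl⟩
    obtain ⟨t, ht, hcard, hmem⟩ := hs.exists_finset_image (r' := StrictReach) Subtype.val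
      fun x _ y _ hne h => by
        have hxy := (ExtQuiver.le_iff.1 h).resolve_left hne
        have : StrictReach x.1 y.1 := ⟨hxy.reachable, fun h' =>
          hne (Subtype.ext (hxy.eq_of_reachable hV h'))⟩
        exact ⟨this, this.ne⟩
    refine ⟨t, ⟨fun x hx => ?_, ht⟩, hcard⟩
    obtain ⟨y, -, rfl⟩ := hmem x hx
    exact isCyclicVertex_iff.1 y.2
  · rintro ⟨s, hs, rfl⟩
    obtain ⟨f, hf, harr⟩ := hs.exists_extArrow hV
    -- The chain is taken in the subtype because `f x` is known to be cyclic only for `x ∈ s`.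
    have hc : IsChain (fun x y : s => StrictReach x.1 y.1) (s.attach : Set s) := by
      intro x _ y _ hxy
      exact hs.2 x.2 y.2 fun h => hxy (Subtype.ext h)
    obtain ⟨t, ht, hcard, -⟩ := hc.exists_finset_image (r' := ExtQuiver.le)
      (fun x => ⟨f x.1, isCyclicVertex_iff.2 ((hs.1 x.1 x.2).of_reachable (hf x.1).1 (hf x.1).2)⟩)
      fun x _ y _ _ h => ⟨ExtQuiver.le_iff.2 (Or.inr (harr _ x.2 _ y.2 h)), fun he => by
        have he : f x.1 = f y.1 := congrArg Subtype.val he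
        exact h.2 ((hf y.1).1.trans (he ▸ (hf x.1).2))⟩
    exact ⟨t, ht, by simpa using hcard⟩

end Quiver

namespace Quiver

variable {V : Type*} [Quiver V]

/-! ### Counting paths -/

/-- The number of paths of length at most `n` that end at `b`, see `card_boundedPathsTo`. -/
noncomputable def pathCount [Fintype V] : ℕ → V → ℕ
  | 0, _ => 1
  | n + 1, b => 1 + ∑ a, Nat.card (a ⟶ b) * pathCount n a

/-- The paths of length at most `n` that end at `b`. -/
def BoundedPathsTo (n : ℕ) (b : V) := {p : Σ a, Path a b // p.2.length ≤ n}

/-- A path of bounded length is trivial or decomposes at its last arrow. -/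
def boundedPathsToSuccEquiv (n : ℕ) (b : V) :
    BoundedPathsTo (n + 1) b ≃ Option (Σ a, (a ⟶ b) × BoundedPathsTo n a) where
  toFun
    | ⟨⟨_, .nil⟩, _⟩ => none
    | ⟨⟨a, .cons p e⟩, h⟩ => some ⟨_, e, ⟨⟨a, p⟩, Nat.le_of_succ_le_succ h⟩⟩
  invFun
    | none => ⟨⟨b, .nil⟩, Nat.zero_le _⟩
    | some ⟨_, e, ⟨⟨a, p⟩, h⟩⟩ => ⟨⟨a, .cons p e⟩, Nat.succ_le_succ h⟩
  left_inv := by rintro ⟨⟨a, _ | ⟨p, e⟩⟩, h⟩ <;> rfl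
  right_inv := by rintro (_ | ⟨a, e, ⟨⟨c, p⟩, h⟩⟩) <;> rfl

instance (b : V) : Unique (BoundedPathsTo 0 b) where
  default := ⟨⟨b, .nil⟩, le_rfl⟩
  uniq := by
    rintro ⟨⟨a, p⟩, h⟩
    obtain rfl := p.eq_of_length_zero (Nat.le_zero.1 h)
    obtain rfl := p.eq_nil_of_length_zero (Nat.le_zero.1 h)
    rfl

instance [Finite V] [∀ a b : V, Finite (a ⟶ b)] (n : ℕ) (b : V) :
    Finite (BoundedPathsTo n b) := by
  induction n generalizing b with
  | zero => infer_instance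
  | succ n ih => exact .of_equiv _ (boundedPathsToSuccEquiv n b).symm

section Fintype

variable [Fintype V]

theorem one_le_pathCount (n : ℕ) (b : V) : 1 ≤ pathCount n b := by
  cases n <;> simp [pathCount]

theorem pathCount_le_succ (n : ℕ) (b : V) : pathCount n b ≤ pathCount (n + 1) b := by
  induction n generalizing b with
  | zero => exact one_le_pathCount 1 b
  | succ n ih =>
    rw [pathCount, pathCount]
    gcongr with a
    exact ih a

theorem pathCount_mono (b : V) : Monotone fun n => pathCount n b :=
  monotone_nat_of_le_succ fun n => pathCount_le_succ n b

variable [∀ a b : V, Finite (a ⟶ b)]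

theorem card_boundedPathsTo (n : ℕ) (b : V) :
    Nat.card (BoundedPathsTo n b) = pathCount n b := by
  induction n generalizing b with
  | zero => simp [pathCount]
  | succ n ih =>
    rw [Nat.card_congr (boundedPathsToSuccEquiv n b), Finite.card_option, Nat.card_sigma,
      pathCount, add_comm]
    simp [Nat.card_prod, ih]

theorem one_add_pathCount_le {a b : V} (e : a ⟶ b) (n : ℕ) :
    1 + pathCount n a ≤ pathCount (n + 1) b := by
  have : 0 < Nat.card (a ⟶ b) := Nat.card_pos_iff.2 ⟨⟨e⟩, inferInstance⟩
  rw [pathCount]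
  gcongr
  exact (Nat.le_mul_of_pos_left _ this).trans
    (Finset.single_le_sum (f := fun a => Nat.card (a ⟶ b) * pathCount n a)
      (fun _ _ => Nat.zero_le _) (Finset.mem_univ a))

theorem pathCount_le_of_path {a b : V} (p : Path a b) (n : ℕ) :
    pathCount n a ≤ pathCount (n + p.length) b := by
  induction p with
  | nil => simp
  | cons p e ih =>
    rw [Path.length_cons, ← add_assoc]
    exact ih.trans ((Nat.le_add_left _ 1).trans (one_add_pathCount_le e _))

/-- Paths ending with different arrows are different. -/
theorem pathCount_add_pathCount_le {a a' b : V} (e : a ⟶ b) (e' : a' ⟶ b)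
    (h : (⟨a, b, e⟩ : Total V) ≠ ⟨a', b, e'⟩) (n : ℕ) :
    pathCount n a + pathCount n a' ≤ pathCount (n + 1) b := by
  classical
  have hpos : ∀ {c : V}, (c ⟶ b) → pathCount n c ≤ Nat.card (c ⟶ b) * pathCount n c :=
    fun f => Nat.le_mul_of_pos_left _ (Nat.card_pos_iff.2 ⟨⟨f⟩, inferInstance⟩)
  rw [pathCount]
  refine le_trans ?_ (Nat.le_add_left _ 1)
  -- Parallel arrows give multiplicity at least two in one summand; otherwise there are two
  -- summands.
  by_cases haa' : a = a'
  · subst haa'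
    have hne : e ≠ e' := fun h' => h (by rw [h'])
    have : 1 < Nat.card (a ⟶ b) := Finite.one_lt_card_iff_nontrivial.2 ⟨e, e', hne⟩
    refine le_trans ?_ (Finset.single_le_sum
      (f := fun a => Nat.card (a ⟶ b) * pathCount n a)
      (fun _ _ => Nat.zero_le _) (Finset.mem_univ a))
    rw [← two_mul]
    exact Nat.mul_le_mul_right _ this
  · calc _ ≤ ∑ c ∈ {a, a'}, Nat.card (c ⟶ b) * pathCount n c := by
          rw [Finset.sum_pair haa']
          exact Nat.add_le_add (hpos e) (hpos e')
      _ ≤ _ := Finset.sum_le_univ_sum_of_nonneg fun _ => Nat.zero_le _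

/-- If two arrows of a strong component end at the same vertex, then the number of paths grows
exponentially. -/
theorem exists_two_pow_le_pathCount (h : ¬ ExclusiveCycles V) :
    ∃ (c : ℕ) (x : V), ∀ n, 2 ^ n ≤ pathCount (c * n) x := by
  simp only [ExclusiveCycles, not_forall] at h
  obtain ⟨a, a', x, e, e', ⟨p⟩, ⟨q⟩, hne⟩ := h
  -- One period has room for returning along `p` or `q`, and for the final arrow `e` or `e'`.
  refine ⟨p.length + q.length + 1, x, fun n => ?_⟩
  induction n with
  | zero => simp [pathCount]
  | succ n ih =>
    calc 2 ^ (n + 1) = 2 ^ n + 2 ^ n := by ring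
      _ ≤ pathCount ((p.length + q.length + 1) * n + (p.length + q.length)) a
          + pathCount ((p.length + q.length + 1) * n + (p.length + q.length)) a' := by
        refine Nat.add_le_add (ih.trans ?_) (ih.trans ?_)
        · exact (pathCount_le_of_path p _).trans (pathCount_mono a (by omega))
        · exact (pathCount_le_of_path q _).trans (pathCount_mono a' (by omega))
      _ ≤ _ := pathCount_add_pathCount_le e e' hne _

/-! ### Lower bound -/

/-- Each turn around the closed path adds at least one path. This starts the induction along a
strict chain. -/
theorem OnClosedPath.choose_le_pathCount {z : V} (hz : OnClosedPath z) :
    ∃ c : ℕ, ∀ m, m.choose 1 ≤ pathCount (c * m) z := by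
  obtain ⟨p, hp⟩ := hz
  refine ⟨p.length, fun m => ?_⟩
  rw [Nat.choose_one_right]
  cases p with
  | nil => simp at hp
  | @cons a _ p e =>
    induction m with
    | zero => exact Nat.zero_le _
    | succ m ih =>
      have h₁ := pathCount_le_of_path p ((p.cons e).length * m)
      have h₂ := one_add_pathCount_le e ((p.cons e).length * m + p.length)
      have h₃ : (p.cons e).length * (m + 1) = (p.cons e).length * m + p.length + 1 := by
        rw [Nat.mul_succ, Path.length_cons, add_assoc]
      rw [h₃]
      omega

/-- Passing from one strong component to another one that contains a cycle increases the growth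
of the number of paths. -/
theorem choose_succ_le_pathCount {w z : V} {d c : ℕ} (hz : OnClosedPath z) (h : StrictReach w z)
    (hw : ∀ m, m.choose d ≤ pathCount (c * m) w) :
    ∃ c' : ℕ, ∀ m, m.choose (d + 1) ≤ pathCount (c' * m) z := by
  obtain ⟨r⟩ := h.1
  -- The arrow `e` enters the component of `z` from outside, so it differs from the arrow `f` by
  -- which a closed path returns to `y`.
  obtain ⟨a, ha, y, hy, e, r₁, r₂, -⟩ := r.exists_notMem_mem_hom_path_path_of_notMem_mem
    {x | Reachable z x} h.2 Reachable.rfl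
  obtain ⟨p, hp⟩ := hz.of_reachable hy ⟨r₂⟩
  cases p with
  | nil => simp at hp
  | @cons b _ p f =>
    have hab : (⟨a, y, e⟩ : Total V) ≠ ⟨b, y, f⟩ := fun hab => by
      obtain rfl : a = b := congrArg Total.left hab
      exact ha (Reachable.trans hy ⟨p⟩)
    obtain ⟨k, hk⟩ : ∃ k, k = c + p.length + r₁.length + 1 := ⟨_, rfl⟩
    have key : ∀ m, m.choose (d + 1) ≤ pathCount (k * m) y := fun m => by
      induction m with
      | zero => simp
      | succ m ih =>
        -- Pascal's rule mirrors the last arrow: `m.choose d` bounds the paths arriving by `e`,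
        -- `m.choose (d + 1)` those that make another turn and arrive by `f`.
        calc (m + 1).choose (d + 1) = m.choose d + m.choose (d + 1) := Nat.choose_succ_succ _ _
          _ ≤ pathCount (k * m + (c + p.length + r₁.length)) a
              + pathCount (k * m + (c + p.length + r₁.length)) b := by
            refine Nat.add_le_add ((hw m).trans ?_) (ih.trans ?_)
            · refine (pathCount_le_of_path r₁ _).trans (pathCount_mono a ?_)
              have : c * m ≤ k * m := Nat.mul_le_mul_right _ (by omega)
              show c * m + r₁.length ≤ _
              omega
            · exact (pathCount_le_of_path p _).trans (pathCount_mono b (by omega))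
          _ ≤ pathCount (k * m + (c + p.length + r₁.length) + 1) y :=
            pathCount_add_pathCount_le e f hab _
          _ = _ := by rw [Nat.mul_succ, add_assoc, ← hk]
    refine ⟨k + r₂.length, fun m => ?_⟩
    -- The one-time cost `r₂.length` fits into the slope only for positive `m`; at zero the binomial
    -- coefficient vanishes.
    rcases m with _ | m
    · simp
    · refine (key _).trans ((pathCount_le_of_path r₂ _).trans (pathCount_mono z ?_))
      rw [Nat.add_mul]
      exact Nat.add_le_add_left (Nat.le_mul_of_pos_right _ m.succ_pos) _

theorem IsStrictChain.choose_le_pathCount {s : Finset V} {z : V} (hs : IsStrictChain s)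
    (hz : z ∈ s) (htop : ∀ x ∈ s, x ≠ z → StrictReach x z) :
    ∃ c : ℕ, ∀ m, m.choose s.card ≤ pathCount (c * m) z := by
  classical
  induction hn : s.card generalizing s z with
  | zero => exact absurd hz (by simp [Finset.card_eq_zero.1 hn])
  | succ n ih =>
    have hcard : (s.erase z).card = n := by rw [Finset.card_erase_of_mem hz, hn]; rfl
    rcases (s.erase z).eq_empty_or_nonempty with h0 | hne
    · obtain rfl : n = 0 := by rw [← hcard, h0]; rfl
      exact (hs.1 z hz).choose_le_pathCount
    · have hs' := hs.subset (s.erase_subset z)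
      obtain ⟨w, hw, hwtop⟩ := hs'.exists_top hne
      obtain ⟨c, hc⟩ := ih hs' hw hwtop hcard
      exact choose_succ_le_pathCount (hs.1 z hz)
        (htop w (Finset.mem_of_mem_erase hw) (Finset.ne_of_mem_erase hw)) hc

end Fintype

/-! ### Upper bound -/

section Fintype

variable [Fintype V]

open Classical in
/-- The maximal size of a strict chain of vertices from which `b` can be reached. -/
noncomputable def chainHeight (b : V) : ℕ :=
  (Finset.univ.filter fun s : Finset V => IsStrictChain s ∧ ∀ x ∈ s, Reachable x b).sup
    Finset.card

theorem IsStrictChain.card_le_chainHeight {s : Finset V} {b : V} (hs : IsStrictChain s)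
    (h : ∀ x ∈ s, Reachable x b) : s.card ≤ chainHeight b := by
  classical
  exact Finset.le_sup (f := Finset.card) (by simpa using ⟨hs, h⟩)

theorem exists_card_eq_chainHeight (b : V) :
    ∃ s : Finset V, IsStrictChain s ∧ (∀ x ∈ s, Reachable x b) ∧ s.card = chainHeight b := by
  classical
  obtain ⟨s, hs, h⟩ := Finset.exists_mem_eq_sup
    (Finset.univ.filter fun s : Finset V => IsStrictChain s ∧ ∀ x ∈ s, Reachable x b)
    ⟨∅, Finset.mem_filter.2 ⟨Finset.mem_univ _, ⟨by simp, by simp⟩, by simp⟩⟩ Finset.card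
  simp only [Finset.mem_filter, Finset.mem_univ, true_and] at hs
  exact ⟨s, hs.1, hs.2, by rw [chainHeight, ← h]⟩

theorem chainHeight_mono {a b : V} (h : Reachable a b) : chainHeight a ≤ chainHeight b := by
  obtain ⟨s, hs, hsa, hcard⟩ := exists_card_eq_chainHeight a
  rw [← hcard]
  exact hs.card_le_chainHeight fun x hx => (hsa x hx).trans h

/-- Adding `b` to a longest strict chain above which `a` lies gives a longer one for `b`. -/
theorem StrictReach.chainHeight_lt {a b : V} (h : StrictReach a b) (hb : OnClosedPath b) :
    chainHeight a < chainHeight b := by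
  classical
  obtain ⟨s, hs, hsa, hcard⟩ := exists_card_eq_chainHeight a
  have hlt : ∀ x ∈ s, StrictReach x b := fun x hx =>
    ⟨(hsa x hx).trans h.1, fun h' => h.2 (h'.trans (hsa x hx))⟩
  have hbs : b ∉ s := fun hbs => (hlt b hbs).ne rfl
  have : IsStrictChain (insert b s) := by
    refine ⟨fun x hx => ?_, ?_⟩
    · rcases Finset.mem_insert.1 hx with rfl | hx
      · exact hb
      · exact hs.1 x hx
    · rw [Finset.coe_insert]
      exact hs.2.insert fun x hx _ => Or.inr (hlt x hx)
  have := this.card_le_chainHeight (b := b) fun x hx => by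
    rcases Finset.mem_insert.1 hx with rfl | hx
    · exact .rfl
    · exact (hlt x hx).1
  rw [Finset.card_insert_of_notMem hbs] at this
  omega

variable (V) in
/-- The number of arrows. -/
noncomputable def arrowCount : ℕ := ∑ b : V, ∑ a : V, Nat.card (a ⟶ b)

/-- In the path recursion, one more factor `1 + arrowCount V` absorbs the trivial path and all
arrows into `b`. -/
theorem one_add_sum_mul_le (b : V) {c e : ℕ} (hc : 0 < c) :
    1 + ∑ a : V, Nat.card (a ⟶ b) * ((1 + arrowCount V) ^ e * c) ≤
      (1 + arrowCount V) ^ (e + 1) * c := by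
  have h₁ : ∑ a : V, Nat.card (a ⟶ b) ≤ arrowCount V :=
    Finset.single_le_sum (f := fun b => ∑ a : V, Nat.card (a ⟶ b))
      (fun _ _ => Nat.zero_le _) (Finset.mem_univ b)
  have h₂ : 1 ≤ (1 + arrowCount V) ^ e * c := Nat.mul_pos (Nat.pow_pos (by omega)) hc
  rw [← Finset.sum_mul]
  calc _ ≤ (1 + arrowCount V) ^ e * c + arrowCount V * ((1 + arrowCount V) ^ e * c) := by gcongr
    _ = _ := by ring

/-- A predecessor outside the component of `b` has fewer ancestors, which frees a factor for
`one_add_sum_mul_le`. If `b` is on a cycle, such predecessors also have smaller height, and exactly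
one arrow comes from the component itself; summing the lower-degree contributions over the steps
raises the degree by one. -/
theorem ExclusiveCycles.pathCount_le (hV : ExclusiveCycles V) (n : ℕ) (b : V) :
    pathCount n b ≤ (1 + arrowCount V) ^ ancestorCount b * (n + 1) ^ chainHeight b := by
  classical
  induction n generalizing b with
  | zero =>
    rw [pathCount, zero_add, one_pow, mul_one]
    exact Nat.one_le_pow _ _ (by omega)
  | succ n ih =>
    have hanc : ∀ a, StrictReach a b → ∀ e, (1 + arrowCount V) ^ ancestorCount a * e ≤
        (1 + arrowCount V) ^ (ancestorCount b - 1) * e := fun a h e =>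
      Nat.mul_le_mul_right _ (Nat.pow_le_pow_right (by omega) (by have := h.ancestorCount_lt; omega))
    obtain ⟨g, hg⟩ : ∃ g, ancestorCount b = g + 1 := by
      refine ⟨ancestorCount b - 1, (Nat.sub_add_cancel ?_).symm⟩
      exact Finset.card_pos.2 ⟨b, by simp [Reachable.rfl]⟩
    rw [hg, Nat.add_sub_cancel] at hanc
    by_cases hb : OnClosedPath b
    · have hcyc : ∃ a₀, Reachable a₀ b ∧ Reachable b a₀ ∧ Nat.card (a₀ ⟶ b) = 1 ∧
          ∀ a, (a ⟶ b) → Reachable b a → a = a₀ := by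
        obtain ⟨p, hp⟩ := hb
        cases p with
        | nil => simp at hp
        | @cons a₀ _ p e =>
          refine ⟨a₀, e.reachable, ⟨p⟩, ?_, fun a f ha => congrArg Total.left (hV f e ha ⟨p⟩)⟩
          rw [Nat.card_eq_one_iff_unique]
          refine ⟨⟨fun f f' => ?_⟩, ⟨e⟩⟩
          simpa using hV f f' ⟨p⟩ ⟨p⟩
      obtain ⟨a₀, ha₀, ha₀', hone, huniq⟩ := hcyc
      obtain ⟨h, hh⟩ : ∃ h, chainHeight b = h + 1 := by
        refine ⟨chainHeight b - 1, (Nat.sub_add_cancel ?_).symm⟩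
        refine le_trans ?_ (IsStrictChain.card_le_chainHeight (s := {b}) ⟨?_, ?_⟩ ?_) <;>
          simp [hb, Reachable.rfl]
      have hterm : ∀ a, Nat.card (a ⟶ b) * pathCount n a ≤
          (if a = a₀ then pathCount n a₀ else 0) +
            Nat.card (a ⟶ b) * ((1 + arrowCount V) ^ g * (n + 1) ^ h) := fun a => by
        split_ifs with haa
        · rw [haa, hone, one_mul]
          exact Nat.le_add_right _ _
        · rcases isEmpty_or_nonempty (a ⟶ b) with h0 | ⟨⟨f⟩⟩
          · simp
          have hlt : StrictReach a b := ⟨f.reachable, fun h' => haa (huniq a f h')⟩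
          rw [zero_add]
          refine Nat.mul_le_mul_left _ ((ih a).trans ((hanc a hlt _).trans ?_))
          have := hlt.chainHeight_lt hb
          exact Nat.mul_le_mul_left _ (Nat.pow_le_pow_right (by omega) (by omega))
      have hpred : pathCount n a₀ ≤ (1 + arrowCount V) ^ (g + 1) * (n + 1) ^ (h + 1) := by
        rw [← hg, ← hh]
        exact (ih a₀).trans (Nat.mul_le_mul
          (Nat.pow_le_pow_right (by omega) (ancestorCount_mono ha₀))
          (Nat.pow_le_pow_right (by omega) (chainHeight_mono ha₀)))
      have hbound := one_add_sum_mul_le b (c := (n + 1) ^ h) (e := g) (Nat.pow_pos (by omega))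
      calc pathCount (n + 1) b = 1 + ∑ a, Nat.card (a ⟶ b) * pathCount n a := rfl
        _ ≤ 1 + ∑ a, ((if a = a₀ then pathCount n a₀ else 0) +
            Nat.card (a ⟶ b) * ((1 + arrowCount V) ^ g * (n + 1) ^ h)) := by
          gcongr with a
          exact hterm a
        _ = pathCount n a₀ +
            (1 + ∑ a : V, Nat.card (a ⟶ b) * ((1 + arrowCount V) ^ g * (n + 1) ^ h)) := by
          rw [Finset.sum_add_distrib, Finset.sum_ite_eq' Finset.univ a₀]
          simp only [Finset.mem_univ, if_true]
          ring
        _ ≤ (1 + arrowCount V) ^ (g + 1) * (n + 1) ^ (h + 1) +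
            (1 + arrowCount V) ^ (g + 1) * (n + 1) ^ h := Nat.add_le_add hpred hbound
        -- The discrete integration step: `(n+1)^(h+1) + (n+1)^h = (n+1)^h * (n+2)`.
        _ = (1 + arrowCount V) ^ (g + 1) * ((n + 1) ^ h * (n + 1 + 1)) := by ring
        _ ≤ (1 + arrowCount V) ^ (g + 1) * ((n + 1 + 1) ^ h * (n + 1 + 1)) := by
          gcongr
          omega
        _ = _ := by rw [hg, hh, pow_succ (n + 1 + 1)]
    · have hterm : ∀ a, Nat.card (a ⟶ b) * pathCount n a ≤
          Nat.card (a ⟶ b) * ((1 + arrowCount V) ^ g * (n + 1 + 1) ^ chainHeight b) := fun a => by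
        rcases isEmpty_or_nonempty (a ⟶ b) with h0 | ⟨⟨f⟩⟩
        · simp
        have hlt : StrictReach a b := ⟨f.reachable, fun ⟨p⟩ => hb ⟨p.cons f, by simp⟩⟩
        refine Nat.mul_le_mul_left _ ((ih a).trans ((hanc a hlt _).trans ?_))
        exact Nat.mul_le_mul_left _ ((Nat.pow_le_pow_right (by omega)
          (chainHeight_mono hlt.1)).trans (Nat.pow_le_pow_left (by omega) _))
      calc pathCount (n + 1) b = 1 + ∑ a, Nat.card (a ⟶ b) * pathCount n a := rfl
        _ ≤ 1 + ∑ a, Nat.card (a ⟶ b) *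
            ((1 + arrowCount V) ^ g * (n + 1 + 1) ^ chainHeight b) :=
          Nat.add_le_add_left (Finset.sum_le_sum fun a _ => hterm a) _
        _ ≤ _ := by
          rw [hg]
          exact one_add_sum_mul_le b (Nat.pow_pos (by omega))

end Fintype

end Quiver

open Filter Topology

/-! ### Growth of the path algebra -/

namespace PathAlgebra

open Quiver

variable (k : Type*) [Field k] (V : Type*) [Quiver V]

/-- The subspace spanned by the paths of length at most `n`. -/
noncomputable def pathSpan (n : ℕ) : Submodule k (PathAlgebra k V) :=
  Submodule.span k (ofPath k '' {p : Σ a b : V, Path a b | p.2.2.length ≤ n})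

variable {V} in
theorem ofPath_mem_pathSpan {n : ℕ} {a b : V} (p : Path a b) (h : p.length ≤ n) :
    ofPath k ⟨a, b, p⟩ ∈ pathSpan k V n :=
  Submodule.subset_span ⟨_, h, rfl⟩

theorem pathSpan_mono : Monotone (pathSpan k V) := fun _ _ h =>
  Submodule.span_mono (Set.image_mono fun _ hp => le_trans hp h)

variable {V} in
theorem exists_mem_pathSpan (x : PathAlgebra k V) : ∃ n, x ∈ pathSpan k V n := by
  induction x using induction with
  | h0 => exact ⟨0, zero_mem _⟩
  | hadd x y hx hy =>
    obtain ⟨n, hn⟩ := hx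
    obtain ⟨m, hm⟩ := hy
    exact ⟨max n m, add_mem (pathSpan_mono k V (le_max_left n m) hn)
      (pathSpan_mono k V (le_max_right n m) hm)⟩
  | hs c p => exact ⟨p.2.2.length, Submodule.smul_mem _ c (ofPath_mem_pathSpan k p.2.2 le_rfl)⟩

variable {V} in
theorem exists_le_pathSpan {W : Submodule k (PathAlgebra k V)} (hW : W.FG) :
    ∃ n, W ≤ pathSpan k V n := by
  obtain ⟨t, rfl⟩ := hW
  choose f hf using exists_mem_pathSpan k (V := V)
  exact ⟨t.sup f, Submodule.span_le.2 fun x hx =>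
    pathSpan_mono k V (Finset.le_sup (f := f) hx) (hf x)⟩

variable [Fintype V]

theorem pathSpan_mul_le (n m : ℕ) : pathSpan k V n * pathSpan k V m ≤ pathSpan k V (n + m) := by
  rw [pathSpan, pathSpan, Submodule.span_mul_span, Submodule.span_le]
  rintro _ ⟨_, ⟨⟨a, b, p⟩, hp, rfl⟩, _, ⟨⟨c, d, q⟩, hq, rfl⟩, rfl⟩
  by_cases h : c = b
  · subst h
    change ofPath k _ * ofPath k _ ∈ _
    rw [ofPath_mul_ofPath]
    exact ofPath_mem_pathSpan k _ ((p.length_comp q).trans_le (Nat.add_le_add hp hq))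
  · change ofPath k _ * ofPath k _ ∈ _
    rw [ofPath_mul_ofPath_of_ne k p q h]
    exact zero_mem _

theorem pathSpan_pow_le (n i : ℕ) : pathSpan k V n ^ i ≤ pathSpan k V (n * i) := by
  induction i with
  | zero =>
    rw [pow_zero, Submodule.one_le, one_def]
    exact sum_mem fun a _ => ofPath_mem_pathSpan k _ (Nat.zero_le _)
  | succ i ih =>
    rw [pow_succ, Nat.mul_succ]
    exact (mul_le_mul' ih le_rfl).trans (pathSpan_mul_le k V _ _)

theorem sum_pow_le_pathSpan {W : Submodule k (PathAlgebra k V)} {s : ℕ}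
    (hW : W ≤ pathSpan k V s) (n : ℕ) :
    ∑ i ∈ Finset.range (n + 1), W ^ i ≤ pathSpan k V (s * n) :=
  Finset.sum_induction _ (· ≤ pathSpan k V (s * n)) (fun _ _ => sup_le) bot_le fun i hi =>
    (pow_le_pow_left' hW i).trans ((pathSpan_pow_le k V s i).trans
      (pathSpan_mono k V (Nat.mul_le_mul_left s (Finset.mem_range_succ_iff.1 hi))))

variable {V} in
-- The exponent exceeds the length by one because a trivial path need not be a scalar, hence need
-- not lie in the zeroth power.
theorem ofPath_mem_pow {a b : V} (p : Path a b) :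
    ofPath k ⟨a, b, p⟩ ∈ pathSpan k V 1 ^ (p.length + 1) := by
  induction p with
  | nil =>
    rw [Path.length_nil, zero_add, pow_one]
    exact ofPath_mem_pathSpan k _ (Nat.zero_le _)
  | cons p e ih =>
    rw [Path.length_cons, pow_succ, ← Path.comp_toPath_eq_cons, ← ofPath_mul_ofPath]
    exact Submodule.mul_mem_mul ih (ofPath_mem_pathSpan k _ le_rfl)

theorem pathSpan_le_sum_pow (n : ℕ) :
    pathSpan k V n ≤ ∑ i ∈ Finset.range (n + 1 + 1), pathSpan k V 1 ^ i := by
  refine Submodule.span_le.2 ?_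
  rintro _ ⟨⟨a, b, p⟩, hp, rfl⟩
  have hp : p.length ≤ n := hp
  refine (?_ : pathSpan k V 1 ^ (p.length + 1) ≤ _) (ofPath_mem_pow k p)
  exact Finset.single_le_sum_of_canonicallyOrdered
    (f := fun i => pathSpan k V 1 ^ i) (Finset.mem_range.2 (by omega))

/-- The paths of bounded length, sorted by their end points. -/
def boundedPathsEquiv (n : ℕ) :
    {p : Σ a b : V, Path a b | p.2.2.length ≤ n} ≃ Σ b : V, BoundedPathsTo n b where
  toFun p := ⟨p.1.2.1, ⟨⟨p.1.1, p.1.2.2⟩, p.2⟩⟩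
  invFun p := ⟨⟨p.2.1.1, p.1, p.2.1.2⟩, p.2.2⟩
  left_inv _ := rfl
  right_inv _ := rfl

variable [∀ a b : V, Finite (a ⟶ b)]

theorem finite_boundedPaths (n : ℕ) :
    {p : Σ a b : V, Path a b | p.2.2.length ≤ n}.Finite :=
  Finite.of_equiv _ (boundedPathsEquiv V n).symm

theorem pathSpan_fg (n : ℕ) : (pathSpan k V n).FG :=
  Submodule.fg_span ((finite_boundedPaths V n).image _)

instance (n : ℕ) : FiniteDimensional k (pathSpan k V n) :=
  .of_fg (pathSpan_fg k V n)

theorem finrank_pathSpan (n : ℕ) :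
    Module.finrank k (pathSpan k V n) = ∑ b : V, pathCount n b := by
  have := ((finite_boundedPaths V n).image (ofPath k)).fintype
  have hli : LinearIndepOn k id (ofPath k '' {p : Σ a b : V, Path a b | p.2.2.length ≤ n}) :=
    ((pathBasis k V).linearIndependent.linearIndepOn _).id_image
  have hinj : Function.Injective (ofPath k (V := V)) := (pathBasis k V).injective
  rw [pathSpan, finrank_span_set_eq_card hli, Set.toFinset_card,
    Fintype.card_eq_nat_card, Nat.card_coe_set_eq, Set.ncard_image_of_injective _ hinj,
    ← Nat.card_coe_set_eq, Nat.card_congr (boundedPathsEquiv V n),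
    Nat.card_sigma]
  simp only [card_boundedPathsTo]

end PathAlgebra

/-! ### From path counts to the Gelfand–Kirillov dimension -/

theorem tendsto_affine_div_affine_log (a b D : ℝ) :
    Tendsto (fun n : ℕ => (D * Real.log (n + 1) + a) / (b + Real.log (n + 1))) atTop (𝓝 D) := by
  have hlog : Tendsto (fun n : ℕ => b + Real.log (n + 1)) atTop atTop :=
    tendsto_atTop_add_const_left _ b (Real.tendsto_log_atTop.comp
      (tendsto_atTop_add_const_right _ 1 tendsto_natCast_atTop_atTop))
  -- The quotient equals `D + (a - D * b) / (b + log (n + 1))` once the denominator is positive.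
  have h := (hlog.const_div_atTop (a - D * b)).const_add D
  rw [add_zero] at h
  refine h.congr' ?_
  filter_upwards [hlog.eventually_gt_atTop 0] with n hn
  field_simp
  ring

namespace PathAlgebra

open Quiver

variable (k : Type*) [Field k] {V : Type*} [Quiver V] [Fintype V]

theorem gkDim_nonneg (A : Type*) [Ring A] [Algebra k A] : 0 ≤ gkDim k A := by
  refine le_iSup₂_of_le ⊥ Submodule.fg_bot (le_limsup_of_frequently_le (Frequently.of_forall ?_))
  exact fun n => EReal.coe_nonneg.2 (div_nonneg (Real.log_natCast_nonneg _)
    (Real.log_natCast_nonneg _))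

variable [∀ a b : V, Finite (a ⟶ b)]

theorem le_gkDim_of_choose_le_pathCount {d c : ℕ} {x : V}
    (h : ∀ m, m.choose d ≤ pathCount (c * m) x) : (d : EReal) ≤ gkDim k (PathAlgebra k V) := by
  set F : ℕ → ℕ := fun n =>
    Module.finrank k ↥(∑ i ∈ Finset.range (n + 1), pathSpan k V 1 ^ i) with hF
  have hFle : ∀ n, pathCount n x ≤ F (n + 1) := fun n => by
    have hfin : FiniteDimensional k
        ↥(∑ i ∈ Finset.range (n + 1 + 1), pathSpan k V 1 ^ i) :=
      Submodule.finiteDimensional_of_le (sum_pow_le_pathSpan k V le_rfl (n + 1))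
    calc pathCount n x ≤ ∑ b, pathCount n b :=
          Finset.single_le_sum (f := fun b => pathCount n b) (fun _ _ => Nat.zero_le _)
            (Finset.mem_univ x)
      _ = Module.finrank k (pathSpan k V n) := (finrank_pathSpan k V n).symm
      _ ≤ F (n + 1) := Submodule.finrank_mono (pathSpan_le_sum_pow k V n)
  -- A subsequence suffices to bound a limsup below. The shift by `d` gives `(m + d).choose d ≥ (m +
  -- 1) ^ d / d!`, the slope `c + 1` makes `φ` unbounded even for `c = 0`, and the final `1` is the
  -- shift in `hFle`.
  set φ : ℕ → ℕ := fun m => (c + 1) * (m + d) + 1 with hφ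
  have hφt : Tendsto φ atTop atTop := tendsto_atTop_mono (fun m => by
    simp only [hφ, id]; nlinarith) tendsto_id
  have hFφ : ∀ m, (m + 1) ^ d ≤ d.factorial * F (φ m) := fun m => by
    have h₁ : (m + d).choose d ≤ F (φ m) :=
      (h (m + d)).trans ((pathCount_mono x (Nat.mul_le_mul_right _ c.le_succ)).trans (hFle _))
    have h₂ := Nat.pow_sub_le_descFactorial (m + d) d
    rw [Nat.descFactorial_eq_factorial_mul_choose, show m + d + 1 - d = m + 1 by omega] at h₂
    exact h₂.trans (Nat.mul_le_mul_left _ h₁)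
  set K : ℕ := (c + 1) * (d + 1) + 1 with hK
  have hφK : ∀ m, φ m ≤ K * (m + 1) := fun m => by
    simp only [hφ, hK]
    nlinarith [Nat.zero_le (c * d * m), Nat.zero_le (d * m), Nat.zero_le (c * m)]
  set g : ℕ → ℝ := fun m => (d * Real.log (m + 1) + -Real.log d.factorial) /
    (Real.log K + Real.log (m + 1)) with hg
  have hgle : ∀ m, 1 ≤ m → g m ≤ Real.log (F (φ m)) / Real.log (φ m) := fun m hm => by
    have hpos : 0 < F (φ m) := Nat.pos_of_ne_zero fun h0 => by
      have := hFφ m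
      rw [h0, mul_zero] at this
      exact absurd this (Nat.not_le.2 (Nat.pow_pos (by omega)))
    have hφ2 : 1 < φ m := by simp only [hφ]; nlinarith
    have hlogφ : 0 < Real.log (φ m) := Real.log_pos (by exact_mod_cast hφ2)
    have h₁ : d * Real.log (m + 1) + -Real.log d.factorial ≤ Real.log (F (φ m)) := by
      have := Real.log_le_log (by positivity)
        (show ((m : ℝ) + 1) ^ d ≤ d.factorial * F (φ m) by exact_mod_cast hFφ m)
      rw [Real.log_pow, Real.log_mul (by positivity) (by positivity)] at this
      linarith
    have h₂ : Real.log (φ m) ≤ Real.log K + Real.log (m + 1) := by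
      rw [← Real.log_mul (by positivity) (by positivity)]
      exact Real.log_le_log (by positivity) (by exact_mod_cast hφK m)
    exact (div_le_div_of_nonneg_right h₁ (hlogφ.le.trans h₂)).trans
      (div_le_div_of_nonneg_left (Real.log_natCast_nonneg _) hlogφ h₂)
  have hlim : Tendsto (fun m => (g m : EReal)) atTop (𝓝 (d : EReal)) := by
    have := tendsto_affine_div_affine_log (-Real.log d.factorial) (Real.log K) d
    exact (continuous_coe_real_ereal.tendsto _).comp this
  calc (d : EReal) = limsup (fun m => (g m : EReal)) atTop := hlim.limsup_eq.symm
    _ ≤ limsup (fun m => ((Real.log (F (φ m)) / Real.log (φ m) : ℝ) : EReal)) atTop :=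
      limsup_le_limsup (eventually_atTop.2 ⟨1, fun m hm => EReal.coe_le_coe_iff.2 (hgle m hm)⟩)
    _ = limsup (fun n : ℕ => ((Real.log (F n) / Real.log n : ℝ) : EReal)) (map φ atTop) := rfl
    _ ≤ limsup (fun n : ℕ => ((Real.log (F n) / Real.log n : ℝ) : EReal)) atTop :=
      limsup_le_limsup_of_le hφt
    _ ≤ gkDim k (PathAlgebra k V) :=
      le_iSup₂_of_le (pathSpan k V 1) (pathSpan_fg k V 1) le_rfl

theorem gkDim_le_of_pathCount_le {D C : ℕ}
    (h : ∀ n (b : V), pathCount n b ≤ C * (n + 1) ^ D) :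
    gkDim k (PathAlgebra k V) ≤ (D : EReal) := by
  refine iSup₂_le fun W hW => ?_
  obtain ⟨s, hs⟩ := exists_le_pathSpan k hW
  -- For `n ≥ 1`, `s * n + 1 ≤ (s + 1) * n`; the added `1` keeps `B` positive, as its logarithm
  -- requires.
  set B : ℕ := (Fintype.card V * C + 1) * (s + 1) ^ D with hB
  have hdim : ∀ n : ℕ, 1 ≤ n →
      Module.finrank k ↥(∑ i ∈ Finset.range (n + 1), W ^ i) ≤ B * n ^ D := fun n hn =>
    calc Module.finrank k ↥(∑ i ∈ Finset.range (n + 1), W ^ i)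
        ≤ Module.finrank k (pathSpan k V (s * n)) :=
          Submodule.finrank_mono (sum_pow_le_pathSpan k V hs n)
      _ = ∑ b : V, pathCount (s * n) b := finrank_pathSpan k V _
      _ ≤ ∑ _b : V, C * (s * n + 1) ^ D := Finset.sum_le_sum fun b _ => h _ b
      _ = Fintype.card V * C * (s * n + 1) ^ D := by
        rw [Finset.sum_const, smul_eq_mul, Finset.card_univ, mul_assoc]
      _ ≤ (Fintype.card V * C + 1) * ((s + 1) * n) ^ D := by
        gcongr
        · omega
        · nlinarith
      _ = B * n ^ D := by rw [mul_pow, hB]; ring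
  have hB1 : 1 ≤ B := Nat.mul_pos (Nat.succ_pos _) (Nat.pow_pos (Nat.succ_pos _))
  have hlim : Tendsto (fun n : ℕ => (((D * Real.log n + Real.log B) / Real.log n : ℝ) : EReal))
      atTop (𝓝 (D : EReal)) := by
    have := tendsto_affine_div_affine_log (Real.log B) 0 D
    have := (tendsto_add_atTop_iff_nat (f := fun n : ℕ =>
      ((D * Real.log n + Real.log B) / Real.log n : ℝ)) 1).1 (by simpa using this)
    exact (continuous_coe_real_ereal.tendsto _).comp this
  rw [← hlim.limsup_eq]
  refine limsup_le_limsup (eventually_atTop.2 ⟨1, fun n hn => EReal.coe_le_coe_iff.2 ?_⟩)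
  refine div_le_div_of_nonneg_right ?_ (Real.log_natCast_nonneg n)
  have hBn : D * Real.log n + Real.log B = Real.log ((B * n ^ D : ℕ) : ℝ) := by
    push_cast
    rw [Real.log_mul (by positivity) (by positivity), Real.log_pow, add_comm]
  rw [hBn]
  rcases Nat.eq_zero_or_pos (Module.finrank k ↥(∑ i ∈ Finset.range (n + 1), W ^ i)) with h0 | h0
  -- In dimension zero the default `Real.log 0 = 0` applies.
  · rw [h0, Nat.cast_zero, Real.log_zero]
    exact Real.log_natCast_nonneg _
  · exact Real.log_le_log (by exact_mod_cast h0) (by exact_mod_cast hdim n hn)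

theorem exclusiveCycles_of_gkDim_lt_top (h : gkDim k (PathAlgebra k V) < ⊤) :
    ExclusiveCycles V := by
  by_contra hV
  obtain ⟨c, x, hc⟩ := exists_two_pow_le_pathCount hV
  refine h.ne (EReal.eq_top_iff_forall_lt _ |>.2 fun y => ?_)
  obtain ⟨d, hd⟩ := exists_nat_gt y
  -- Exponential growth dominates `m.choose d` for every `d`, so the dimension exceeds every real
  -- number.
  refine lt_of_lt_of_le ?_ (le_gkDim_of_choose_le_pathCount k (d := d) (c := c) (x := x)
    fun m => (Nat.choose_le_two_pow m d).trans (hc m))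
  exact_mod_cast hd

end PathAlgebra

theorem proposition7p2 (k : Type*) [Field k] (V : Type*) [Quiver V] [Fintype V]
    [∀ a b : V, Finite (a ⟶ b)] (hfin : gkDim k (PathAlgebra k V) < ⊤) :
    IsPartialOrder (Quiver.SimpleCycles V) Quiver.SimpleCycles.le ∧
    IsPartialOrder (Quiver.ExtQuiver V) Quiver.ExtQuiver.le ∧
    (∀ d : ℕ, HasChain (Quiver.SimpleCycles.le (V := V)) d ↔
      HasChain (Quiver.ExtQuiver.le (V := V)) d) ∧
    ∃ D : ℕ, IsGreatest {d : ℕ | HasChain (Quiver.ExtQuiver.le (V := V)) d} D ∧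
      gkDim k (PathAlgebra k V) = (D : EReal) := by
  have hV := PathAlgebra.exclusiveCycles_of_gkDim_lt_top k hfin
  refine ⟨Quiver.SimpleCycles.isPartialOrder hV, Quiver.ExtQuiver.isPartialOrder hV,
    fun d => by rw [Quiver.hasChain_simpleCycles_iff hV, Quiver.hasChain_extQuiver_iff hV], ?_⟩
  simp only [Quiver.hasChain_extQuiver_iff hV]
  obtain ⟨D, ⟨s, hs, hsD⟩, hmax⟩ : ∃ D, IsGreatest
      {d : ℕ | ∃ s : Finset V, Quiver.IsStrictChain s ∧ s.card = d} D := by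
    refine BddAbove.exists_isGreatest_of_nonempty ⟨Fintype.card V, ?_⟩
      ⟨0, ∅, ⟨by simp, by simp⟩, rfl⟩
    rintro _ ⟨s, -, rfl⟩
    exact s.card_le_univ
  refine ⟨D, ⟨⟨s, hs, hsD⟩, hmax⟩, le_antisymm ?_ ?_⟩
  · refine PathAlgebra.gkDim_le_of_pathCount_le k
      (C := (1 + Quiver.arrowCount V) ^ Fintype.card V) fun n b => (hV.pathCount_le n b).trans ?_
    refine Nat.mul_le_mul (Nat.pow_le_pow_right (by omega) (Quiver.ancestorCount_le_card b))
      (Nat.pow_le_pow_right (by omega) ?_)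
    obtain ⟨t, ht, -, htb⟩ := Quiver.exists_card_eq_chainHeight b
    exact hmax ⟨t, ht, htb⟩
  -- An empty maximal chain has no top vertex at which to count paths; then `D = 0`.
  · rcases s.eq_empty_or_nonempty with rfl | hne
    · rw [← hsD]
      simpa using PathAlgebra.gkDim_nonneg k (PathAlgebra k V)
    · obtain ⟨z, hz, htop⟩ := hs.exists_top hne
      obtain ⟨c, hc⟩ := hs.choose_le_pathCount hz htop
      exact PathAlgebra.le_gkDim_of_choose_le_pathCount k (hsD ▸ hc)
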